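/- Conventions. Let $k$ be a commutative ring with identity; all algebras are commutative unital $k$-algebras. Let $G$ be a finite group. A *unital partial action* $\alpha_G=(S_g,\alpha_g)_{g\in G}$ of $G$ on $S$ consists of ideals $S_g=S1_g$ of $S$, with $1_g$ idempotent, and $k$-algebra isomorphisms $\alpha_g:S_{g^{-1}}\to S_g$ such that $S_1=S$, $\alpha_1=\mathrm{id}_S$, $\alpha_g(S_{g^{-1}}\cap S_h)=S_g\cap S_{gh}$, and $\alpha_g(\alpha_h(x))=\alpha_{gh}(x)$ whenever $x\in S_{h^{-1}}$ and $\alpha_h(x)\in S_{g^{-1}}$ (for all $g,h\in G$). For a subgroup $H\le G$ put $S^{\alpha_H}=\{s\in S:\alpha_h(s1_{h^{-1}})=s1_h\ \text{for all } h\in H\}$. $S$ is a *partial $\alpha_G$-Galois extension of $R$* if an isomorphism of $k$-algebras $R\simeq S^{\alpha_G}$ is given and there are $m\in\mathbb N$ and $x_i,y_i\in S$ $(1\le i\le m)$ with $\sum_{i}x_i\alpha_g(y_i1_{g^{-1}})=\delta_{1,g}$ for all $g\in G$. Then $S$, and each $S^{\alpha_H}\supseteq S^{\alpha_G}\simeq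 R$, is an $R$-algebra. A *globalization* of $(S,\alpha_G)$ is a $k$-algebra $T$ with an action $\beta$ of $G$ by $k$-algebra automorphisms and an injective multiplicative $k$-linear map $\varphi:S\to T$ (not necessarily preserving $1$) such that $\varphi(S)$ is an ideal of $T$, $\varphi(S_g)=\varphi(S)\cap\beta_g(\varphi(S))$, $\beta_g(\varphi(x))=\varphi(\alpha_g(x))$ for $x\in S_{g^{-1}}$, and $T=\sum_{g\in G}\beta_g(\varphi(S))$. We regard $S$ as an ideal of $T$ by means of $\varphi$. For $H\le G$ put $T^{\beta_H}=\{t\in T:\beta_h(t)=t\ \text{for all } h\in H\}$. Multiplication by $1_S$ is an isomorphism $T^{\beta_G}\simeq S^{\alpha_G}$, so that $T^{\beta_G}\simeq S^{\alpha_G}\simeq R$. *Quotients.* Let $H=\{h_1=1,h_2,\dots,h_m\}$ be a normal subgroup of $G$. Put $e_i=\prod_{j<i}(1_T-\beta_{h_j}(1_S))\cdot\beta_{h_i}(1_S)$, $\psi_H(t)=\sum_{i=1}^m\beta_{h_i}(t)e_i$ for $t\in T$, and $e_H=\psi_H(1_S)$. Then $\psi_H(S^{\alpha_H})=T^{\beta_H}e_H$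 and $T^{\beta_H}1_S=S^{\alpha_H}$. The partial action $\alpha_{G/H}$ of $G/H$ on $S^{\alpha_H}$ has the ideals $\tilde D_{gH}=T^{\beta_H}e_H\beta_g(e_H)1_S$ and the isomorphisms $\alpha_{gH}:\tilde D_{g^{-1}H}\to\tilde D_{gH}$, $\alpha_{gH}(x)=\beta_g(\psi_H(x))1_S$. *Partial isomorphism.* Let $(B,\theta)$ and $(B',\theta')$ be $R$-algebras with unital partial actions $\theta=(B_q,\theta_q)_{q\in Q}$ and $\theta'=(B'_q,\theta'_q)_{q\in Q}$ of a group $Q$. They are *partially $Q$-isomorphic* if there is an $R$-linear $k$-algebra isomorphism $f:B\to B'$ with $f(B_q)\subseteq B'_q$ and $f\circ\theta_q=\theta'_q\circ f$ on $B_{q^{-1}}$, for all $q\in Q$. **Theorem.** Let $(S,\alpha_G)$ and $(S',\alpha'_G)$ be unital partial actions of $G$ such that $S$ and $S'$ are, respectively, partial $\alpha_G$- and $\alpha'_G$-Galois extensions of $R$, and let $(T,\beta_G)$ and $(T',\beta'_G)$ be their globalizations. Let $A=T^{\beta_G}$, identified with $(T')^{\beta'_G}$ by means of $T^{\beta_G}\simeq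 S^{\alpha_G}\simeq R\simeq (S')^{\alpha'_G}\simeq (T')^{\beta'_G}$. The following are equivalent: (i) there is an $A$-linear isomorphism of $k$-algebras $f:T\to T'$ with $f\circ\beta_g=\beta'_g\circ f$ for all $g\in G$ and $f(1_S)=1_{S'}$; (ii) for every normal subgroup $H$ of $G$, $(S^{\alpha_H},\alpha_{G/H})$ and $((S')^{\alpha'_H},\alpha'_{G/H})$ are partially $G/H$-isomorphic; (iii) $(S,\alpha_G)$ and $(S',\alpha'_G)$ are partially $G$-isomorphic. -/

import Mathlib

/-- A partial action of a group `G` on a commutative `k`-algebra `S`: ideals `S_g = dom g` and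
`k`-algebra isomorphisms `α_g = act g : S_{g⁻¹} → S_g`. -/
structure PartialAction (k G S : Type*) [CommRing k] [Group G] [CommRing S] [Algebra k S] where
  dom : G → Ideal S
  act : ∀ g : G, dom g⁻¹ ≃ₗ[k] dom g
  act_mul : ∀ (g : G) (x y : dom g⁻¹),
    (act g ⟨(x : S) * y, Ideal.mul_mem_right _ _ x.2⟩ : S) = (act g x : S) * (act g y : S)
  dom_one : dom 1 = ⊤
  act_one : ∀ x : dom (1 : G)⁻¹, (act 1 x : S) = x
  /-- `α_g (S_{g⁻¹} ∩ S_h) = S_g ∩ S_{gh}`. -/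
  act_inter : ∀ g h : G,
    {y : S | ∃ x : dom g⁻¹, (x : S) ∈ dom h ∧ (act g x : S) = y} = (dom g : Set S) ∩ dom (g * h)
  /-- `α_g (α_h x) = α_{gh} x` whenever `α_h x` is defined and lies in `S_{g⁻¹}`. -/
  act_act : ∀ (g h : G) (x : dom h⁻¹) (hx : (act h x : S) ∈ dom g⁻¹),
    ∃ hx' : (x : S) ∈ dom (g * h)⁻¹, (act g ⟨act h x, hx⟩ : S) = act (g * h) ⟨x, hx'⟩

/-- A partial action is unital if every `S_g` is generated by an idempotent `1_g = one g`
(which is then unique). -/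
structure UnitalPartialAction (k G S : Type*) [CommRing k] [Group G] [CommRing S] [Algebra k S]
    extends PartialAction k G S where
  one : G → S
  one_idem : ∀ g, IsIdempotentElem (one g)
  dom_eq : ∀ g, dom g = Ideal.span {one g}

namespace UnitalPartialAction

variable {k G S : Type*} [CommRing k] [Group G] [CommRing S] [Algebra k S]
  (α : UnitalPartialAction k G S)

theorem mul_one_mem (g : G) (s : S) : s * α.one g ∈ α.dom g := by
  rw [α.dom_eq]
  exact Ideal.mul_mem_left _ _ (Ideal.subset_span rfl)

theorem mul_one_of_mem {g : G} {s : S} (hs : s ∈ α.dom g) : s * α.one g = s := by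
  rw [α.dom_eq, Ideal.mem_span_singleton'] at hs
  obtain ⟨a, rfl⟩ := hs
  rw [mul_assoc, (α.one_idem g).eq]

/-- The map `s ↦ α_g (s 1_{g⁻¹})`. -/
def ext (g : G) (s : S) : S := α.act g ⟨s * α.one g⁻¹, α.mul_one_mem g⁻¹ s⟩

theorem ext_of_mem {g : G} (x : α.dom g⁻¹) : α.ext g x = α.act g x := by
  unfold ext
  congr 2
  exact Subtype.ext (α.mul_one_of_mem x.2)

theorem ext_mem (g : G) (s : S) : α.ext g s ∈ α.dom g := (α.act g _).2

theorem ext_add (g : G) (s t : S) : α.ext g (s + t) = α.ext g s + α.ext g t := by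
  unfold ext
  rw [← Submodule.coe_add, ← map_add]
  congr 2
  exact Subtype.ext (add_mul _ _ _)

theorem ext_smul (g : G) (c : k) (s : S) : α.ext g (c • s) = c • α.ext g s := by
  unfold ext
  have : (⟨c • s * α.one g⁻¹, α.mul_one_mem g⁻¹ _⟩ : α.dom g⁻¹) =
      c • ⟨s * α.one g⁻¹, α.mul_one_mem g⁻¹ s⟩ := Subtype.ext (smul_mul_assoc _ _ _)
  rw [this, map_smul]
  rfl

theorem ext_mul (g : G) (s t : S) : α.ext g (s * t) = α.ext g s * α.ext g t := by
  unfold ext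
  rw [← α.act_mul]
  congr 2
  refine Subtype.ext ?_
  change s * t * α.one g⁻¹ = s * α.one g⁻¹ * (t * α.one g⁻¹)
  linear_combination (-s * t) * (α.one_idem g⁻¹).eq

theorem ext_one (g : G) : α.ext g 1 = α.one g := by
  obtain ⟨x, hx⟩ := (α.act g).surjective ⟨1 * α.one g, α.mul_one_mem g 1⟩
  have h1 : α.ext g x = α.one g := by
    rw [ext_of_mem, hx]
    exact one_mul _
  have h2 : α.ext g 1 * α.one g = α.ext g 1 := α.mul_one_of_mem (α.ext_mem g 1)
  rw [← h2, ← h1, ← ext_mul, one_mul]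

/-- The subalgebra of invariants
`S^{α_H} = {s ∈ S | α_h (s 1_{h⁻¹}) = s 1_h for all h ∈ H}` of a subgroup `H`. -/
def invariants (H : Subgroup G) : Subalgebra k S where
  carrier := {s | ∀ h ∈ H, α.ext h s = s * α.one h}
  mul_mem' := by
    intro s t hs ht h hh
    rw [ext_mul, hs h hh, ht h hh]
    linear_combination (s * t) * (α.one_idem h).eq
  add_mem' := by
    intro s t hs ht h hh
    rw [ext_add, hs h hh, ht h hh, add_mul]
  algebraMap_mem' := by
    intro c h _
    rw [Algebra.algebraMap_eq_smul_one, ext_smul, ext_one, smul_mul_assoc, one_mul]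

end UnitalPartialAction

/-- `S` is a partial `α_G`-extension (partial Galois extension) of `R` by means of `ι : R → S`:
the `k`-algebra homomorphism `ι` is an isomorphism of `R` onto `S^{α_G}`, and `S` has partial Galois
coordinates. -/
structure IsPartialExtension {k G R S : Type*} [CommRing k] [Group G] [CommRing R] [Algebra k R]
    [CommRing S] [Algebra k S] (α : UnitalPartialAction k G S) (ι : R →ₐ[k] S) : Prop where
  injective : Function.Injective ι
  range_eq : ι.range = α.invariants ⊤
  coordinates : ∃ (m : ℕ) (x y : Fin m → S),
    (∑ i, x i * α.ext 1 (y i) = 1) ∧ ∀ g : G, g ≠ 1 → ∑ i, x i * α.ext g (y i) = 0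

/-- `(S, α)` and `(S', α')` are partially `G`-isomorphic, where `S` and `S'` are `R`-algebras by
means of `ι` and `ι'`: there is an `R`-linear `k`-algebra isomorphism `f : S → S'` with
`f (S_g) ⊆ S'_g` and `f ∘ α_g = α'_g ∘ f` on `S_{g⁻¹}` for all `g`. -/
def PartiallyIsomorphic {k G R S S' : Type*} [CommRing k] [Group G] [CommRing R] [Algebra k R]
    [CommRing S] [Algebra k S] [CommRing S'] [Algebra k S']
    (α : PartialAction k G S) (ι : R →ₐ[k] S) (α' : PartialAction k G S') (ι' : R →ₐ[k] S') :
    Prop :=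
  ∃ f : S ≃ₐ[k] S', (∀ (r : R) (s : S), f (ι r * s) = ι' r * f s) ∧
    ∃ hf : ∀ (g : G) (s : S), s ∈ α.dom g → f s ∈ α'.dom g,
      ∀ (g : G) (x : α.dom g⁻¹), f (α.act g x) = α'.act g ⟨f x, hf g⁻¹ x x.2⟩

/-- A global action `β` of `G` on `T`, together with a (not necessarily unit preserving)
homomorphism `φ : S → T`, is a globalization of `α`. -/
structure IsGlobalization {k G S T : Type*} [CommRing k] [Group G] [CommRing S] [Algebra k S]
    [CommRing T] [Algebra k T] (α : PartialAction k G S) (β : G →* (T ≃ₐ[k] T))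
    (φ : S →ₙₐ[k] T) : Prop where
  injective : Function.Injective φ
  /-- `φ(S)` is an ideal of `T`. -/
  isIdeal : ∃ I : Ideal T, (I : Set T) = Set.range φ
  /-- `φ(S_g) = φ(S) ∩ β_g(φ(S))`. -/
  image_dom : ∀ g : G, φ '' (α.dom g : Set S) = Set.range φ ∩ β g '' Set.range φ
  /-- `β_g (φ x) = φ (α_g x)` for `x ∈ S_{g⁻¹}`. -/
  map_act : ∀ (g : G) (x : α.dom g⁻¹), β g (φ x) = φ (α.act g x)
  /-- `T = ∑_g β_g(φ(S))`. -/
  span_eq : ⨆ g : G, Submodule.map (β g).toLinearMap (LinearMap.range (φ : S →ₗ[k] T)) = ⊤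

/-- The subalgebra `T^{β_H}` of invariants of a subgroup `H` under a global action `β`. -/
def globalInvariants {k G T : Type*} [CommRing k] [Group G] [CommRing T] [Algebra k T]
    (β : G →* (T ≃ₐ[k] T)) (H : Subgroup G) : Subalgebra k T where
  carrier := {t | ∀ h ∈ H, β h t = t}
  mul_mem' := by
    intro s t hs ht h hh
    rw [map_mul, hs h hh, ht h hh]
  add_mem' := by
    intro s t hs ht h hh
    rw [map_add, hs h hh, ht h hh]
  algebraMap_mem' := by
    intro c h _
    exact (β h).commutes c

section QuotientAction

variable {k G T : Type*} [CommRing k] [Group G] [CommRing T] [Algebra k T]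
  (β : G →* (T ≃ₐ[k] T)) (H : Subgroup G) [H.Normal]

theorem globalInvariants_map_mem (g : G) {t : T} (ht : t ∈ globalInvariants β H) :
    β g t ∈ globalInvariants β H := by
  intro h hh
  have h1 : h * g = g * (g⁻¹ * h * g) := by group
  have h2 : g⁻¹ * h * g ∈ H := by
    simpa using (inferInstance : H.Normal).conj_mem h hh g⁻¹
  rw [← AlgEquiv.mul_apply, ← map_mul, h1, map_mul, AlgEquiv.mul_apply, ht _ h2]

/-- The restriction of a global action to `T^{β_H}`, for `H` normal. -/
def globalInvariantsAction :
    G →* (globalInvariants β H ≃ₐ[k] globalInvariants β H) where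
  toFun g := AlgEquiv.ofAlgHom
    (((β g : T →ₐ[k] T).comp (globalInvariants β H).val).codRestrict _
      fun t => globalInvariants_map_mem β H g t.2)
    (((β g⁻¹ : T →ₐ[k] T).comp (globalInvariants β H).val).codRestrict _
      fun t => globalInvariants_map_mem β H g⁻¹ t.2)
    (by
      ext t
      change β g (β g⁻¹ t) = t
      rw [← AlgEquiv.mul_apply, ← map_mul, mul_inv_cancel, map_one, AlgEquiv.one_apply])
    (by
      ext t
      change β g⁻¹ (β g t) = t
      rw [← AlgEquiv.mul_apply, ← map_mul, inv_mul_cancel, map_one, AlgEquiv.one_apply])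
  map_one' := by
    ext t
    change β 1 (t : T) = t
    rw [map_one, AlgEquiv.one_apply]
  map_mul' g g' := by
    ext t
    change β (g * g') (t : T) = β g (β g' t)
    rw [map_mul, AlgEquiv.mul_apply]

/-- The action `β_{G/H}` of `G/H` on `T^{β_H}`: the coset `gH` acts as `β_g`. -/
def quotientAction : G ⧸ H →* (globalInvariants β H ≃ₐ[k] globalInvariants β H) :=
  QuotientGroup.lift H (globalInvariantsAction β H) (by
    intro h hh
    ext t
    exact t.2 h hh)

end QuotientAction

open Classical in
/-- An enumeration `h_1, …, h_m` of a finite subgroup (indexed from `0`) with `h_1 = 1`. -/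
noncomputable def subgroupEnum {G : Type*} [Group G] [Finite G] (H : Subgroup G) :
    Fin (Nat.card H) ≃ H :=
  (Finite.equivFin H).symm.trans
    (Equiv.swap ((Finite.equivFin H).symm ⟨0, Nat.card_pos⟩) 1)

theorem subgroupEnum_zero {G : Type*} [Group G] [Finite G] (H : Subgroup G) :
    subgroupEnum H ⟨0, Nat.card_pos⟩ = 1 := by
  simp [subgroupEnum]

section Psi

variable {k G S T : Type*} [CommRing k] [Group G] [Finite G] [CommRing S] [Algebra k S]
  [CommRing T] [Algebra k T] (β : G →* (T ≃ₐ[k] T)) (φ : S →ₙₐ[k] T) (H : Subgroup G)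

/-- The idempotents
`e_i = (1_T - β_{h_1}(1_S)) ⋯ (1_T - β_{h_{i-1}}(1_S)) β_{h_i}(1_S)` of `T`, where `1_S` is regarded
as an element of `T` by means of `φ`. -/
noncomputable def enumIdem (i : Fin (Nat.card H)) : T :=
  (∏ j ∈ Finset.univ.filter (fun j => j < i), (1 - β (subgroupEnum H j) (φ 1))) *
    β (subgroupEnum H i) (φ 1)

/-- The map `ψ_H : T → T`, `ψ_H(t) = ∑_i β_{h_i}(t) e_i`. -/
noncomputable def psi (t : T) : T := ∑ i, β (subgroupEnum H i) t * enumIdem β φ H i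

end Psi

section Restrict

variable {k Q B C : Type*} [CommRing k] [Group Q] [CommRing B] [Algebra k B]
  [CommRing C] [Algebra k C] (γ : Q →* (C ≃ₐ[k] C)) (m : C →ₐ[k] B) (ψ : B →ₙₐ[k] C)

theorem restrict_mem_iff (h1 : ∀ b, m (ψ b) = b) (h2 : ∀ c, ψ (m c) = c * ψ 1) (q : Q) (b : B) :
    b ∈ Ideal.span {m (ψ 1 * γ q (ψ 1))} ↔ ψ b * γ q (ψ 1) = ψ b := by
  have he : ψ 1 * ψ 1 = ψ 1 := by rw [← map_mul, mul_one]
  have hge : γ q (ψ 1) * γ q (ψ 1) = γ q (ψ 1) := by rw [← map_mul, he]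
  rw [Ideal.mem_span_singleton']
  constructor
  · rintro ⟨a, rfl⟩
    rw [map_mul, h2]
    linear_combination (ψ a * ψ 1 * ψ 1) * hge
  · intro hb
    refine ⟨b, ?_⟩
    nth_rewrite 1 [← h1 b]
    have hb1 : ψ b * ψ 1 = ψ b := by rw [← map_mul, mul_one]
    rw [← map_mul, ← mul_assoc, hb1, hb, h1]

theorem restrict_map_mem (h1 : ∀ b, m (ψ b) = b) (h2 : ∀ c, ψ (m c) = c * ψ 1) (q : Q) (b : B)
    (hb : b ∈ Ideal.span {m (ψ 1 * γ q⁻¹ (ψ 1))}) :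
    ψ (m (γ q (ψ b))) = γ q (ψ b) := by
  rw [restrict_mem_iff γ m ψ h1 h2] at hb
  rw [h2]
  have h3 := congrArg (γ q) hb
  rwa [map_mul, ← AlgEquiv.mul_apply, ← map_mul, mul_inv_cancel, map_one,
    AlgEquiv.one_apply] at h3

theorem restrict_mem (h1 : ∀ b, m (ψ b) = b) (h2 : ∀ c, ψ (m c) = c * ψ 1) (q : Q) (b : B)
    (hb : b ∈ Ideal.span {m (ψ 1 * γ q⁻¹ (ψ 1))}) :
    m (γ q (ψ b)) ∈ Ideal.span {m (ψ 1 * γ q (ψ 1))} := by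
  rw [restrict_mem_iff γ m ψ h1 h2, restrict_map_mem γ m ψ h1 h2 q b hb, ← map_mul, ← map_mul,
    mul_one]

theorem restrict_inv (h1 : ∀ b, m (ψ b) = b) (h2 : ∀ c, ψ (m c) = c * ψ 1) (q : Q) (b : B)
    (hb : b ∈ Ideal.span {m (ψ 1 * γ q⁻¹ (ψ 1))}) :
    m (γ q⁻¹ (ψ (m (γ q (ψ b))))) = b := by
  rw [restrict_map_mem γ m ψ h1 h2 q b hb, ← AlgEquiv.mul_apply, ← map_mul, inv_mul_cancel,
    map_one, AlgEquiv.one_apply, h1]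

/-- Let `ψ : B → C` be a monomorphism onto the ideal `C e`, `e = ψ 1`, with inverse the
restriction of `m : C → B`. The global action `γ` of `Q` on `C` induces on `C e` a partial action
with domains `C e γ_q(e)`, which is transported here to `B`: the domains are `m (C e γ_q(e))` and
the isomorphisms are `m ∘ γ_q ∘ ψ`. -/
def restrictAction (h1 : ∀ b, m (ψ b) = b) (h2 : ∀ c, ψ (m c) = c * ψ 1) :
    UnitalPartialAction k Q B where
  dom q := Ideal.span {m (ψ 1 * γ q (ψ 1))}
  act q :=
    { toFun := fun b => ⟨m (γ q (ψ b)), restrict_mem γ m ψ h1 h2 q b b.2⟩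
      invFun := fun b => ⟨m (γ q⁻¹ (ψ b)), restrict_mem γ m ψ h1 h2 q⁻¹ b (by
        rw [inv_inv]; exact b.2)⟩
      map_add' := fun x y => Subtype.ext (by simp)
      map_smul' := fun c x => Subtype.ext (by simp)
      left_inv := fun b => Subtype.ext (restrict_inv γ m ψ h1 h2 q b b.2)
      right_inv := fun b => Subtype.ext (by
        have := restrict_inv γ m ψ h1 h2 q⁻¹ b (by rw [inv_inv]; exact b.2)
        rwa [inv_inv] at this) }
  act_mul q x y := by simp
  dom_one := by
    have he : ψ 1 * ψ 1 = ψ 1 := by rw [← map_mul, mul_one]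
    rw [map_one γ, AlgEquiv.one_apply, he, h1, Ideal.span_singleton_one]
  act_one x := by
    change m (γ 1 (ψ x)) = x
    rw [map_one, AlgEquiv.one_apply, h1]
  act_inter q r := by
    ext y
    constructor
    · rintro ⟨x, hx, rfl⟩
      refine ⟨restrict_mem γ m ψ h1 h2 q x x.2, ?_⟩
      change m (γ q (ψ x)) ∈ Ideal.span _
      rw [restrict_mem_iff γ m ψ h1 h2] at hx ⊢
      rw [restrict_map_mem γ m ψ h1 h2 q x x.2, map_mul γ, AlgEquiv.mul_apply, ← map_mul, hx]
    · rintro ⟨hy, hy'⟩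
      have hy2 : y ∈ Ideal.span {m (ψ 1 * γ q⁻¹⁻¹ (ψ 1))} := by rwa [inv_inv]
      refine ⟨⟨m (γ q⁻¹ (ψ y)), restrict_mem γ m ψ h1 h2 q⁻¹ y hy2⟩, ?_, ?_⟩
      · change m (γ q⁻¹ (ψ y)) ∈ Ideal.span _
        change y ∈ Ideal.span _ at hy'
        rw [restrict_mem_iff γ m ψ h1 h2] at hy' ⊢
        rw [restrict_map_mem γ m ψ h1 h2 q⁻¹ y hy2]
        have h3 := congrArg (γ q⁻¹) hy'
        rwa [map_mul, ← AlgEquiv.mul_apply (γ q⁻¹) (γ (q * r)), ← map_mul γ,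
          inv_mul_cancel_left] at h3
      · change m (γ q (ψ (m (γ q⁻¹ (ψ y))))) = y
        have := restrict_inv γ m ψ h1 h2 q⁻¹ y hy2
        rwa [inv_inv] at this
  act_act q r x hx := by
    have hx0 := restrict_map_mem γ m ψ h1 h2 r x x.2
    change m (γ r (ψ x)) ∈ Ideal.span _ at hx
    refine ⟨?_, ?_⟩
    · rw [restrict_mem_iff γ m ψ h1 h2] at hx ⊢
      rw [hx0] at hx
      have h3 := congrArg (γ r⁻¹) hx
      rwa [map_mul, ← AlgEquiv.mul_apply, ← AlgEquiv.mul_apply, ← map_mul γ, ← map_mul γ,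
        inv_mul_cancel, map_one, AlgEquiv.one_apply, ← mul_inv_rev] at h3
    · change m (γ q (ψ (m (γ r (ψ x))))) = m (γ (q * r) (ψ x))
      rw [hx0, map_mul γ, AlgEquiv.mul_apply]
  one q := m (ψ 1 * γ q (ψ 1))
  one_idem q := by
    have he : ψ 1 * ψ 1 = ψ 1 := by rw [← map_mul, mul_one]
    have hge : γ q (ψ 1) * γ q (ψ 1) = γ q (ψ 1) := by rw [← map_mul, he]
    change m _ * m _ = m _
    rw [← map_mul]
    congr 1
    linear_combination (γ q (ψ 1) * γ q (ψ 1)) * he + ψ 1 * hge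
  dom_eq _ := rfl

end Restrict

namespace IsGlobalization

variable {k G S T : Type*} [CommRing k] [Group G] [CommRing S] [Algebra k S]
  [CommRing T] [Algebra k T] {α : UnitalPartialAction k G S} {β : G →* (T ≃ₐ[k] T)}
  {φ : S →ₙₐ[k] T}

theorem one_mul_one (φ : S →ₙₐ[k] T) : φ 1 * φ 1 = φ 1 := by rw [← map_mul, mul_one]

theorem exists_preimage (hT : IsGlobalization α.toPartialAction β φ) (t : T) :
    ∃ s, φ s = t * φ 1 := by
  obtain ⟨I, hI⟩ := hT.isIdeal
  have h1 : φ 1 ∈ (I : Set T) := by rw [hI]; exact ⟨1, rfl⟩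
  have h2 : t * φ 1 ∈ (I : Set T) := I.mul_mem_left t h1
  rwa [hI] at h2

theorem map_one_idem (hT : IsGlobalization α.toPartialAction β φ) (g : G) :
    φ (α.one g) = φ 1 * β g (φ 1) := by
  have h1 : φ (α.one g) ∈ φ '' (α.dom g : Set S) :=
    ⟨_, by simpa using α.mul_one_mem g 1, rfl⟩
  rw [hT.image_dom] at h1
  obtain ⟨-, t, ⟨s, rfl⟩, hs⟩ := h1
  have h2 : φ 1 * β g (φ 1) ∈ φ '' (α.dom g : Set S) := by
    rw [hT.image_dom]
    constructor
    · obtain ⟨s, hs⟩ := hT.exists_preimage (β g (φ 1))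
      exact ⟨s, by rw [hs, mul_comm]⟩
    · obtain ⟨s, hs⟩ := hT.exists_preimage (β g⁻¹ (φ 1))
      refine ⟨φ s, ⟨s, rfl⟩, ?_⟩
      rw [hs, map_mul, ← AlgEquiv.mul_apply, ← map_mul β, mul_inv_cancel, map_one,
        AlgEquiv.one_apply]
  obtain ⟨y, hy, hy'⟩ := h2
  have h3 : φ (α.one g) * β g (φ 1) = φ (α.one g) := by
    rw [← hs, ← map_mul, ← map_mul, mul_one]
  have h4 : φ (α.one g) * φ 1 = φ (α.one g) := by rw [← map_mul, mul_one]
  have h5 : φ y * φ (α.one g) = φ y := by rw [← map_mul, α.mul_one_of_mem hy]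
  rw [hy'] at h5
  linear_combination h5 - β g (φ 1) * h4 - h3

theorem map_ext (hT : IsGlobalization α.toPartialAction β φ) (g : G) (s : S) :
    φ (α.ext g s) = β g (φ s) * φ 1 := by
  unfold UnitalPartialAction.ext
  rw [← hT.map_act]
  change β g (φ (s * α.one g⁻¹)) = _
  rw [map_mul, hT.map_one_idem, map_mul, map_mul, ← AlgEquiv.mul_apply, ← map_mul β,
    mul_inv_cancel, map_one β, AlgEquiv.one_apply, ← mul_assoc, ← map_mul, ← map_mul, mul_one]

theorem mem_invariants_iff (hT : IsGlobalization α.toPartialAction β φ) (H : Subgroup G) (s : S) :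
    s ∈ α.invariants H ↔ ∀ h ∈ H, β h (φ s) * φ 1 = φ s * β h (φ 1) := by
  refine forall₂_congr fun h _ => ?_
  rw [← hT.injective.eq_iff, hT.map_ext, map_mul, hT.map_one_idem, ← mul_assoc, ← map_mul, mul_one]

/-- The multiplication by `1_S` as a `k`-algebra homomorphism `T → S`. -/
noncomputable def mulOne (hT : IsGlobalization α.toPartialAction β φ) : T →ₐ[k] S :=
  AlgHom.ofLinearMap
    { toFun := fun t => (hT.exists_preimage t).choose
      map_add' := fun s t => hT.injective (by
        rw [map_add, (hT.exists_preimage _).choose_spec, (hT.exists_preimage s).choose_spec,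
          (hT.exists_preimage t).choose_spec, add_mul])
      map_smul' := fun c t => hT.injective (by
        rw [map_smul, (hT.exists_preimage _).choose_spec, (hT.exists_preimage t).choose_spec,
          smul_mul_assoc, RingHom.id_apply]) }
    (hT.injective (by
      change φ (hT.exists_preimage 1).choose = _
      rw [(hT.exists_preimage _).choose_spec, one_mul]))
    (fun s t => hT.injective (by
      change φ (hT.exists_preimage _).choose =
        φ ((hT.exists_preimage _).choose * (hT.exists_preimage _).choose)
      rw [map_mul, (hT.exists_preimage _).choose_spec, (hT.exists_preimage s).choose_spec,
          (hT.exists_preimage t).choose_spec]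
      linear_combination (-s * t) * one_mul_one φ))

theorem map_mulOne (hT : IsGlobalization α.toPartialAction β φ) (t : T) :
    φ (hT.mulOne t) = t * φ 1 :=
  (hT.exists_preimage t).choose_spec

theorem mulOne_mem (hT : IsGlobalization α.toPartialAction β φ) (H : Subgroup G) {t : T}
    (ht : t ∈ globalInvariants β H) : hT.mulOne t ∈ α.invariants H := by
  rw [hT.mem_invariants_iff]
  intro h hh
  rw [hT.map_mulOne, map_mul, ht h hh]
  ring

/-- The multiplication by `1_S` as a `k`-algebra homomorphism `T^{β_H} → S^{α_H}`. -/
noncomputable def mulOneInv (hT : IsGlobalization α.toPartialAction β φ) (H : Subgroup G) :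
    globalInvariants β H →ₐ[k] α.invariants H :=
  (hT.mulOne.comp (globalInvariants β H).val).codRestrict _ fun t => hT.mulOne_mem H t.2

theorem swap (hT : IsGlobalization α.toPartialAction β φ) (H : Subgroup G) {s : S}
    (hs : s ∈ α.invariants H) {h h' : G} (hh : h ∈ H) (hh' : h' ∈ H) :
    β h (φ s) * β h' (φ 1) = β h' (φ s) * β h (φ 1) := by
  rw [hT.mem_invariants_iff] at hs
  have h1 := congrArg (β h') (hs (h'⁻¹ * h) (H.mul_mem (H.inv_mem hh') hh))
  rwa [map_mul (β h'), map_mul (β h'), ← AlgEquiv.mul_apply, ← AlgEquiv.mul_apply, ← map_mul β,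
    mul_inv_cancel_left] at h1

section Psi

variable [Finite G]

theorem sum_enumIdem (β : G →* (T ≃ₐ[k] T)) (φ : S →ₙₐ[k] T) (H : Subgroup G) :
    ∑ i, enumIdem β φ H i = 1 - ∏ i, (1 - β (subgroupEnum H i) (φ 1)) := by
  rw [Finset.prod_one_sub_ordered, sub_sub_cancel]
  exact Finset.sum_congr rfl fun i _ => mul_comm _ _

theorem enumIdem_mul (β : G →* (T ≃ₐ[k] T)) (φ : S →ₙₐ[k] T) (H : Subgroup G)
    (i : Fin (Nat.card H)) :
    β (subgroupEnum H i) (φ 1) * enumIdem β φ H i = enumIdem β φ H i := by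
  have h1 : β (subgroupEnum H i) (φ 1) * β (subgroupEnum H i) (φ 1) =
    β (subgroupEnum H i) (φ 1) := by rw [← map_mul, one_mul_one]
  unfold enumIdem
  rw [mul_left_comm, h1]

theorem mul_sum_enumIdem (β : G →* (T ≃ₐ[k] T)) (φ : S →ₙₐ[k] T) (H : Subgroup G) {h : G}
    (hh : h ∈ H) : β h (φ 1) * ∑ i, enumIdem β φ H i = β h (φ 1) := by
  have h1 : β h (φ 1) * β h (φ 1) = β h (φ 1) := by rw [← map_mul, one_mul_one]
  have h2 : (1 - β (subgroupEnum H ((subgroupEnum H).symm ⟨h, hh⟩)) (φ 1)) ∣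
      ∏ i, (1 - β (subgroupEnum H i) (φ 1)) :=
    Finset.dvd_prod_of_mem (fun i => 1 - β (subgroupEnum H i) (φ 1)) (Finset.mem_univ _)
  rw [Equiv.apply_symm_apply] at h2
  obtain ⟨c, hc⟩ := h2
  rw [sum_enumIdem, hc]
  linear_combination c * h1

theorem eq_zero_of_mul (β : G →* (T ≃ₐ[k] T)) (φ : S →ₙₐ[k] T) (H : Subgroup G) {z : T}
    (hz : z * ∑ i, enumIdem β φ H i = z) (h0 : ∀ h ∈ H, z * β h (φ 1) = 0) : z = 0 := by
  rw [← hz, Finset.mul_sum]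
  refine Finset.sum_eq_zero fun i _ => ?_
  rw [← enumIdem_mul, ← mul_assoc, h0 _ (subgroupEnum H i).2, zero_mul]

theorem psi_mul_sum (β : G →* (T ≃ₐ[k] T)) (φ : S →ₙₐ[k] T) (H : Subgroup G) (t : T) :
    psi β φ H t * ∑ i, enumIdem β φ H i = psi β φ H t := by
  unfold psi
  rw [Finset.sum_mul]
  refine Finset.sum_congr rfl fun i _ => ?_
  have h1 := mul_sum_enumIdem β φ H (subgroupEnum H i).2
  rw [← enumIdem_mul]
  linear_combination (β (subgroupEnum H i) t * enumIdem β φ H i) * h1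

theorem map_sum_enumIdem (β : G →* (T ≃ₐ[k] T)) (φ : S →ₙₐ[k] T) (H : Subgroup G) {h : G}
    (hh : h ∈ H) : β h (∑ i, enumIdem β φ H i) = ∑ i, enumIdem β φ H i := by
  rw [sum_enumIdem, map_sub, map_one, map_prod]
  congr 1
  let e : Fin (Nat.card H) ≃ Fin (Nat.card H) :=
    ((subgroupEnum H).trans (Equiv.mulLeft ⟨h, hh⟩)).trans (subgroupEnum H).symm
  rw [← Equiv.prod_comp e (fun i => 1 - β (subgroupEnum H i) (φ 1))]
  refine Finset.prod_congr rfl fun i _ => ?_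
  have h1 : (subgroupEnum H (e i) : G) = h * subgroupEnum H i := by simp [e]
  rw [h1, map_mul, AlgEquiv.mul_apply, map_sub, map_one]

theorem psi_mul (hT : IsGlobalization α.toPartialAction β φ) (H : Subgroup G) {s : S}
    (hs : s ∈ α.invariants H) {h : G} (hh : h ∈ H) :
    psi β φ H (φ s) * β h (φ 1) = β h (φ s) := by
  have h1 : β h (φ s) * β h (φ 1) = β h (φ s) := by rw [← map_mul, ← map_mul, mul_one]
  have h2 : β h (φ s) * ∑ i, enumIdem β φ H i = β h (φ s) := by
    rw [← h1, mul_assoc, mul_sum_enumIdem β φ H hh]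
  rw [← h2, Finset.mul_sum, psi, Finset.sum_mul]
  refine Finset.sum_congr rfl fun i _ => ?_
  have h3 := hT.swap H hs (subgroupEnum H i).2 hh
  have h4 := enumIdem_mul β φ H i
  linear_combination enumIdem β φ H i * h3 + β h (φ s) * h4

theorem psi_mem (hT : IsGlobalization α.toPartialAction β φ) (H : Subgroup G) {s : S}
    (hs : s ∈ α.invariants H) : psi β φ H (φ s) ∈ globalInvariants β H := by
  intro h hh
  rw [← sub_eq_zero]
  refine eq_zero_of_mul β φ H ?_ ?_
  · have h1 := congrArg (β h) (psi_mul_sum β φ H (φ s))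
    rw [map_mul, map_sum_enumIdem β φ H hh] at h1
    rw [sub_mul, h1, psi_mul_sum]
  · intro g hg
    have h1 := congrArg (β h) (hT.psi_mul H hs (H.mul_mem (H.inv_mem hh) hg))
    rw [map_mul, ← AlgEquiv.mul_apply, ← AlgEquiv.mul_apply, ← map_mul β,
      mul_inv_cancel_left] at h1
    rw [sub_mul, h1, hT.psi_mul H hs hg, sub_self]

/-- The map `ψ_H` as a (not necessarily unit preserving) homomorphism `S^{α_H} → T^{β_H}`. -/
noncomputable def psiInv (hT : IsGlobalization α.toPartialAction β φ) (H : Subgroup G) :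
    α.invariants H →ₙₐ[k] globalInvariants β H where
  toFun s := ⟨psi β φ H (φ s), hT.psi_mem H s.2⟩
  map_smul' c s := Subtype.ext (by simp [psi, Finset.smul_sum])
  map_zero' := Subtype.ext (by simp [psi])
  map_add' s t := Subtype.ext (by simp [psi, add_mul, Finset.sum_add_distrib])
  map_mul' s t := Subtype.ext (by
    change psi β φ H (φ ((s : S) * t)) = psi β φ H (φ s) * psi β φ H (φ t)
    rw [← sub_eq_zero]
    refine eq_zero_of_mul β φ H ?_ ?_
    · rw [sub_mul, psi_mul_sum, mul_assoc, psi_mul_sum]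
    · intro g hg
      have h1 := hT.psi_mul H s.2 hg
      have h2 := hT.psi_mul H t.2 hg
      have h3 := hT.psi_mul H (mul_mem s.2 t.2) hg
      have h4 : β g (φ t) * β g (φ 1) = β g (φ t) := by rw [← map_mul, ← map_mul, mul_one]
      rw [map_mul, map_mul] at h3
      rw [sub_mul, map_mul, h3]
      rw [← h1, ← h2]
      linear_combination (psi β φ H (φ s)) * (β g (φ 1) * h2 + h4 - h2))

theorem mulOneInv_psiInv (hT : IsGlobalization α.toPartialAction β φ) (H : Subgroup G)
    (s : α.invariants H) : hT.mulOneInv H (hT.psiInv H s) = s := by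
  refine Subtype.ext (hT.injective ?_)
  change φ (hT.mulOne (psi β φ H (φ s))) = _
  rw [hT.map_mulOne]
  have := hT.psi_mul H s.2 H.one_mem
  simpa using this

theorem psiInv_mulOneInv (hT : IsGlobalization α.toPartialAction β φ) (H : Subgroup G)
    (t : globalInvariants β H) : hT.psiInv H (hT.mulOneInv H t) = t * hT.psiInv H 1 := by
  refine Subtype.ext ?_
  change psi β φ H (φ (hT.mulOne t)) = t * psi β φ H (φ 1)
  rw [hT.map_mulOne, psi, psi, Finset.mul_sum]
  refine Finset.sum_congr rfl fun i _ => ?_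
  rw [map_mul, t.2 _ (subgroupEnum H i).2, mul_assoc]

/-- The partial action `α_{G/H}` of `G/H` on `S^{α_H}`: with `e_H = ψ_H(1_S)` and
`e_{gH} = e_H β_g(e_H)`, its domains are `T^{β_H} e_{gH} 1_S`, the ideal of `S^{α_H}` generated by
`e_{gH} 1_S`, and its isomorphisms are `x ↦ β_g(ψ_H(x)) 1_S`. -/
noncomputable def quotient (hT : IsGlobalization α.toPartialAction β φ) (H : Subgroup G)
    [H.Normal] : UnitalPartialAction k (G ⧸ H) (α.invariants H) :=
  restrictAction (quotientAction β H) (hT.mulOneInv H) (hT.psiInv H) (hT.mulOneInv_psiInv H)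
    (hT.psiInv_mulOneInv H)

theorem psiInv_top_one (hT : IsGlobalization α.toPartialAction β φ) : hT.psiInv ⊤ 1 = 1 := by
  refine Subtype.ext ?_
  change psi β φ ⊤ (φ 1) = 1
  have key : ∀ t : T, t * psi β φ ⊤ (φ 1) = t := by
    intro t
    have ht : t ∈ ⨆ g : G, Submodule.map (β g).toLinearMap (LinearMap.range (φ : S →ₗ[k] T)) := by
      rw [hT.span_eq]; trivial
    induction ht using Submodule.iSup_induction' with
    | mem g x hx =>
      obtain ⟨_, ⟨s, rfl⟩, rfl⟩ := hx
      change β g (φ s) * _ = β g (φ s)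
      have h1 : β g (φ s) * β g (φ 1) = β g (φ s) := by rw [← map_mul, ← map_mul, mul_one]
      have h2 := hT.psi_mul ⊤ (one_mem (α.invariants ⊤)) (Subgroup.mem_top g)
      linear_combination β g (φ s) * h2 + h1 - (psi β φ ⊤ (φ 1)) * h1
    | zero => exact zero_mul _
    | add x y _ _ hx hy => rw [add_mul, hx, hy]
  simpa using key 1

/-- The multiplication by `1_S` is an isomorphism `T^{β_G} ≃ S^{α_G}`. -/
noncomputable def invariantsEquiv (hT : IsGlobalization α.toPartialAction β φ) :
    globalInvariants β ⊤ ≃ₐ[k] α.invariants ⊤ :=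
  AlgEquiv.ofBijective (hT.mulOneInv ⊤)
    ⟨fun s t h => by
      have h1 := congrArg (hT.psiInv ⊤) h
      rwa [hT.psiInv_mulOneInv, hT.psiInv_mulOneInv, hT.psiInv_top_one, mul_one, mul_one] at h1,
    fun s => ⟨_, hT.mulOneInv_psiInv ⊤ s⟩⟩

/-- If `S` is a partial `α_G`-extension of `R`, then `T^{β_G} ≃ R`: the multiplication by `1_S`
followed by the inverse of `R ≃ S^{α_G}`. -/
noncomputable def baseEquiv {R : Type*} [CommRing R] [Algebra k R]
    (hT : IsGlobalization α.toPartialAction β φ) {ι : R →ₐ[k] S} (hS : IsPartialExtension α ι) :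
    globalInvariants β ⊤ ≃ₐ[k] R :=
  (hT.invariantsEquiv.trans (Subalgebra.equivOfEq _ _ hS.range_eq.symm)).trans
    (AlgEquiv.ofInjective ι hS.injective).symm

end Psi

end IsGlobalization

/-- The `R`-algebra structure `R ≃ S^{α_G} ⊆ S^{α_H}` of `S^{α_H}`. -/
def IsPartialExtension.toInvariants {k G R S : Type*} [CommRing k] [Group G] [CommRing R]
    [Algebra k R] [CommRing S] [Algebra k S] {α : UnitalPartialAction k G S} {ι : R →ₐ[k] S}
    (hS : IsPartialExtension α ι) (H : Subgroup G) : R →ₐ[k] α.invariants H :=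
  ι.codRestrict _ fun r h _ =>
    (show ι r ∈ α.invariants ⊤ by rw [← hS.range_eq]; exact ⟨r, rfl⟩) h (Subgroup.mem_top h)

/-- `((T, β), (S, α))` and `((T', β'), (S', α'))` are `G`-isomorphic: there is a `G`-equivariant
`k`-algebra isomorphism `f : T → T'` with `f(1_S) = 1_{S'}` that is linear over
`A = T^{β_G} ≃ R ≃ (T')^{β'_G}`. -/
def GloballyIsomorphic {k G R S S' T T' : Type*} [CommRing k] [Group G] [Finite G] [CommRing R]
    [Algebra k R] [CommRing S] [Algebra k S] [CommRing S'] [Algebra k S'] [CommRing T]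
    [Algebra k T] [CommRing T'] [Algebra k T']
    {α : UnitalPartialAction k G S} {β : G →* (T ≃ₐ[k] T)} {φ : S →ₙₐ[k] T} {ι : R →ₐ[k] S}
    {α' : UnitalPartialAction k G S'} {β' : G →* (T' ≃ₐ[k] T')} {φ' : S' →ₙₐ[k] T'}
    {ι' : R →ₐ[k] S'}
    (hT : IsGlobalization α.toPartialAction β φ) (hS : IsPartialExtension α ι)
    (hT' : IsGlobalization α'.toPartialAction β' φ') (hS' : IsPartialExtension α' ι') : Prop :=
  ∃ f : T ≃ₐ[k] T',
    (∀ (a : globalInvariants β ⊤) (t : T),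
      f (a * t) = ((hT'.baseEquiv hS').symm (hT.baseEquiv hS a) : T') * f t) ∧
    (∀ (g : G) (t : T), f (β g t) = β' g (f t)) ∧
    f (φ 1) = φ' 1

/-! The implications run (i) ⇒ (ii) ⇒ (iii) ⇒ (i); only the last uses Galois coordinates in an
essential way.

(i) ⇒ (ii): since `f(1_S) = 1_{S'}`, `f` restricts to an isomorphism `F : S ≃ S'` of the ideals
generated by these idempotents. Everything that enters `α_{G/H}` is built from `β` and `1_S`, so `F`
restricts further to `S^{α_H}` and respects the quotient actions. (ii) ⇒ (iii): for the trivial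
subgroup the quotient action is `α` itself, indexed by cosets.

(iii) ⇒ (i): a partial isomorphism `F` is only assumed to satisfy `F(S_g) ⊆ S'_g`. The crux is that
equality holds, that is, `F(1_g) = 1'_g` (`map_one_of_partial`). Put `u_g = F(1_g)`; then `F ∘ α_g =
u_g (α'_g ∘ F)`. Transporting the trace expansion `b = ∑ tr(b y_i) x_i` by `F` and applying `α'_g`
writes `α'_g` as an `S'`-linear combination of the maps `u_h α'_h`. Galois coordinates of `S'`
separate the `α'_h`, and comparing terms at `h = g` gives `1'_g ∈ u_g S'`. Once `F` commutes with
all `α_g`, it extends to `T`: the map `t ↦ (g ↦ β_g(t) 1_S)` embeds `T` in the functions `G → S`,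
with image determined by `α` alone, and `F` applied pointwise carries one image onto the other
(`exists_globalization_equiv`). -/

/-! ### The everywhere defined maps `s ↦ α_g(s 1_{g⁻¹})`. -/

theorem IsGlobalization.ext_ext {k G S T : Type*} [CommRing k] [Group G] [CommRing S] [Algebra k S]
    [CommRing T] [Algebra k T] {α : UnitalPartialAction k G S} {β : G →* (T ≃ₐ[k] T)}
    {φ : S →ₙₐ[k] T} (hT : IsGlobalization α.toPartialAction β φ) (g h : G) (s : S) :
    α.ext g (α.ext h s) = α.ext (g * h) s * α.one g := by
  apply hT.injective
  rw [map_mul, hT.map_ext, hT.map_ext, hT.map_ext, hT.map_one_idem, map_mul, map_mul β,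
    AlgEquiv.mul_apply]
  linear_combination (-(β g (β h (φ s)) * β g (φ 1))) * one_mul_one φ

namespace UnitalPartialAction

variable {k G S : Type*} [CommRing k] [Group G] [CommRing S] [Algebra k S]
  (α : UnitalPartialAction k G S)

/-- `α.ext g` as a `k`-linear map. -/
def extLinear (g : G) : S →ₗ[k] S where
  toFun := α.ext g
  map_add' := α.ext_add g
  map_smul' := α.ext_smul g

theorem ext_sum {I : Type*} (g : G) (A : Finset I) (s : I → S) :
    α.ext g (∑ i ∈ A, s i) = ∑ i ∈ A, α.ext g (s i) :=
  map_sum (α.extLinear g) s A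

theorem ext_mul_one (g : G) (s : S) : α.ext g s * α.one g = α.ext g s :=
  α.mul_one_of_mem (α.ext_mem g s)

theorem one_one : α.one 1 = 1 := by
  have h : (1 : S) ∈ α.dom 1 := by rw [α.dom_one]; trivial
  simpa using α.mul_one_of_mem h

theorem ext_one_apply (s : S) : α.ext 1 s = s := by
  have h : s ∈ α.dom (1 : G)⁻¹ := by rw [inv_one, α.dom_one]; trivial
  rw [α.ext_of_mem ⟨s, h⟩, α.act_one]

theorem mem_dom_iff (g : G) (s : S) : s ∈ α.dom g ↔ s * α.one g = s :=
  ⟨α.mul_one_of_mem, fun h => h ▸ α.mul_one_mem g s⟩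

end UnitalPartialAction

/-! ### The globalization as an algebra of functions on `G`. -/

namespace IsGlobalization

variable {k G S T : Type*} [CommRing k] [Group G] [CommRing S] [Algebra k S]
  [CommRing T] [Algebra k T] {α : UnitalPartialAction k G S} {β : G →* (T ≃ₐ[k] T)}
  {φ : S →ₙₐ[k] T}

/-- This makes the trace take values in `S^{α_G} ≃ R`: applying `α_h` permutes the summands by `g ↦
hg` and multiplies them by `1_h`. -/
theorem sum_ext_mem_invariants [Fintype G] (hT : IsGlobalization α.toPartialAction β φ) (s : S) :
    ∑ g, α.ext g s ∈ α.invariants ⊤ := by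
  intro h _
  rw [α.ext_sum, Finset.sum_mul, ← Equiv.sum_comp (Equiv.mulLeft h) fun g => α.ext g s * α.one h]
  exact Finset.sum_congr rfl fun g _ => hT.ext_ext h g s

/-- The embedding `t ↦ (g ↦ β_g(t) 1_S)` of `T` into the functions `G → S`. -/
noncomputable def toFunctions (hT : IsGlobalization α.toPartialAction β φ) : T →ₐ[k] (G → S) :=
  AlgHom.pi fun g => hT.mulOne.comp (β g : T →ₐ[k] T)

theorem toFunctions_apply (hT : IsGlobalization α.toPartialAction β φ) (t : T) (g : G) :
    hT.toFunctions t g = hT.mulOne (β g t) := rfl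

theorem mulOne_act_map (hT : IsGlobalization α.toPartialAction β φ) (g : G) (s : S) :
    hT.mulOne (β g (φ s)) = α.ext g s :=
  hT.injective (by rw [hT.map_mulOne, hT.map_ext])

/-- In the function model `β` is right translation, so maps applied pointwise are automatically
equivariant. -/
theorem toFunctions_act (hT : IsGlobalization α.toPartialAction β φ) (h : G) (t : T) (g : G) :
    hT.toFunctions (β h t) g = hT.toFunctions t (g * h) := by
  rw [toFunctions_apply, toFunctions_apply, map_mul, AlgEquiv.mul_apply]

theorem toFunctions_act_map (hT : IsGlobalization α.toPartialAction β φ) (h : G) (s : S) (g : G) :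
    hT.toFunctions (β h (φ s)) g = α.ext (g * h) s := by
  rw [toFunctions_act, toFunctions_apply, mulOne_act_map]

theorem induction_on (hT : IsGlobalization α.toPartialAction β φ) {p : T → Prop} (t : T)
    (act_map : ∀ g s, p (β g (φ s))) (add : ∀ x y, p x → p y → p (x + y)) : p t := by
  have ht : t ∈ ⨆ g : G, Submodule.map (β g).toLinearMap (LinearMap.range (φ : S →ₗ[k] T)) := by
    rw [hT.span_eq]; trivial
  induction ht using Submodule.iSup_induction' with
  | mem g x hx =>
    obtain ⟨_, ⟨s, rfl⟩, rfl⟩ := hx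
    exact act_map g s
  | zero => simpa using act_map 1 0
  | add x y _ _ hx hy => exact add x y hx hy

theorem toFunctions_injective (hT : IsGlobalization α.toPartialAction β φ) :
    Function.Injective hT.toFunctions := by
  rw [injective_iff_map_eq_zero]
  intro t ht
  -- If every `β_{g⁻¹}(t) 1_S` vanishes, then `t` kills each `β_g(1_S)`, hence each ideal `β_g(S)`
  -- and their sum `T`.
  have key : ∀ x : T, t * x = 0 := by
    intro x
    induction x using hT.induction_on with
    | act_map g s =>
      have h1 := congrArg φ (congrFun ht g⁻¹)
      rw [toFunctions_apply, hT.map_mulOne, Pi.zero_apply, map_zero] at h1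
      have h2 := congrArg (β g) h1
      rw [map_mul, ← AlgEquiv.mul_apply, ← map_mul β, mul_inv_cancel, map_one β,
        AlgEquiv.one_apply, map_zero] at h2
      have h3 : φ s = φ 1 * φ s := by rw [← map_mul, one_mul]
      rw [h3, map_mul, ← mul_assoc, h2, zero_mul]
    | add x y hx hy => rw [mul_add, hx, hy, add_zero]
  simpa using key 1

section BaseRing

variable [Finite G] {R : Type*} [CommRing R] [Algebra k R] {ι : R →ₐ[k] S}

theorem apply_baseEquiv (hT : IsGlobalization α.toPartialAction β φ) (hS : IsPartialExtension α ι)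
    (a : globalInvariants β ⊤) : ι (hT.baseEquiv hS a) = hT.mulOne a := by
  have h := congrArg Subtype.val (AlgEquiv.apply_symm_apply (AlgEquiv.ofInjective ι hS.injective)
    (Subalgebra.equivOfEq _ _ hS.range_eq.symm (hT.invariantsEquiv a)))
  exact h

/-- Translates `A`-linearity on `T` into `R`-linearity on `S`. -/
theorem map_apply (hT : IsGlobalization α.toPartialAction β φ) (hS : IsPartialExtension α ι)
    (r : R) : φ (ι r) = ((hT.baseEquiv hS).symm r : T) * φ 1 := by
  rw [← hT.map_mulOne, ← hT.apply_baseEquiv hS, AlgEquiv.apply_symm_apply]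

end BaseRing

end IsGlobalization

/-! ### Consequences of Galois coordinates: separation and the trace expansion. -/

namespace IsPartialExtension

variable {k G R S : Type*} [CommRing k] [Group G] [CommRing R] [Algebra k R] [CommRing S]
  [Algebra k S] {α : UnitalPartialAction k G S} {ι : R →ₐ[k] S}

theorem ext_apply_mul (hS : IsPartialExtension α ι) (g : G) (r : R) (s : S) :
    α.ext g (ι r * s) = ι r * α.ext g s := by
  have h : ι r ∈ α.invariants ⊤ := by rw [← hS.range_eq]; exact ⟨r, rfl⟩
  rw [α.ext_mul, h g (Subgroup.mem_top g), mul_assoc, mul_comm (α.one g), α.ext_mul_one]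

/-- Galois coordinates separate the maps `α.ext g`. -/
theorem exists_separating {T : Type*} [CommRing T] [Algebra k T] {β : G →* (T ≃ₐ[k] T)}
    {φ : S →ₙₐ[k] T} (hT : IsGlobalization α.toPartialAction β φ) (hS : IsPartialExtension α ι)
    (g : G) : ∃ (m : ℕ) (a b : Fin m → S), (∑ j, a j * α.ext g (b j) = α.one g) ∧
      ∀ h, h ≠ g → ∑ j, a j * α.ext h (b j) = 0 := by
  obtain ⟨m, x, y, h1, h2⟩ := hS.coordinates
  -- The separating elements come from applying `α_g` to the coordinate relation at `g⁻¹h`, which is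
  -- nonzero only for `h = g`.
  have key (h : G) : ∑ j, α.ext g (x j) * α.ext h (y j) =
      α.ext g (∑ j, x j * α.ext (g⁻¹ * h) (y j)) := by
    rw [α.ext_sum]
    refine Finset.sum_congr rfl fun j _ => ?_
    rw [α.ext_mul, hT.ext_ext, mul_inv_cancel_left]
    rw [mul_comm (α.ext h (y j)), ← mul_assoc, α.ext_mul_one]
  refine ⟨m, fun j => α.ext g (x j), y, ?_, fun h hh => ?_⟩
  · rw [key, inv_mul_cancel, h1, α.ext_one]
  · rw [key, h2 _ (fun h3 => hh (inv_mul_eq_one.mp h3).symm)]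
    exact map_zero (α.extLinear g)

/-- Every `b ∈ S` is a combination `∑ tr(b y_i) x_i` with coefficients in `R`. -/
theorem exists_dual_basis [Fintype G] {T : Type*} [CommRing T] [Algebra k T]
    {β : G →* (T ≃ₐ[k] T)} {φ : S →ₙₐ[k] T} (hT : IsGlobalization α.toPartialAction β φ)
    (hS : IsPartialExtension α ι) : ∃ (m : ℕ) (x y : Fin m → S) (τ : S → R),
      (∀ s, ι (τ s) = ∑ g, α.ext g s) ∧ ∀ b, ∑ i, ι (τ (b * y i)) * x i = b := by
  classical
  obtain ⟨m, x, y, h1, h2⟩ := hS.coordinates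
  have hτ (s : S) : ∃ r, ι r = ∑ g, α.ext g s := by
    have := hT.sum_ext_mem_invariants s
    rwa [← hS.range_eq] at this
  choose τ hτ using hτ
  refine ⟨m, x, y, τ, hτ, fun b => ?_⟩
  calc ∑ i, ι (τ (b * y i)) * x i
      = ∑ i, ∑ g, α.ext g b * (x i * α.ext g (y i)) := by
        refine Finset.sum_congr rfl fun i _ => ?_
        rw [hτ, Finset.sum_mul]
        refine Finset.sum_congr rfl fun g _ => ?_
        rw [α.ext_mul]
        ring
    -- With the sums exchanged, the coordinate relations leave only `g = 1`.
    _ = ∑ g, α.ext g b * ∑ i, x i * α.ext g (y i) := by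
        rw [Finset.sum_comm]
        exact Finset.sum_congr rfl fun g _ => (Finset.mul_sum _ _ _).symm
    _ = b := by
        rw [Finset.sum_eq_single 1 (fun g _ hg => by rw [h2 g hg, mul_zero]) (by simp), h1,
          mul_one, α.ext_one_apply]

end IsPartialExtension

/-! ### From a partial isomorphism to an isomorphism of globalizations. -/

section PartialIsomorphism

variable {k G R S S' T T' : Type*} [CommRing k] [Group G] [CommRing R]
  [Algebra k R] [CommRing S] [Algebra k S] [CommRing S'] [Algebra k S'] [CommRing T]
  [Algebra k T] [CommRing T'] [Algebra k T']
  {α : UnitalPartialAction k G S} {β : G →* (T ≃ₐ[k] T)} {φ : S →ₙₐ[k] T} {ι : R →ₐ[k] S}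
  {α' : UnitalPartialAction k G S'} {β' : G →* (T' ≃ₐ[k] T')} {φ' : S' →ₙₐ[k] T'}
  {ι' : R →ₐ[k] S'}

/-- The factor `F(1_g)` appears because `F(1_{g⁻¹})` may a priori be smaller than `1'_{g⁻¹}`; it
equals `α'_g(F(1_{g⁻¹}))`. -/
theorem map_ext_of_partial {F : S ≃ₐ[k] S'}
    (hF : ∀ (g : G) (s : S), s ∈ α.dom g → F s ∈ α'.dom g)
    (hact : ∀ (g : G) (x : α.dom g⁻¹), F (α.act g x) = α'.act g ⟨F x, hF g⁻¹ x x.2⟩)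
    (g : G) (s : S) : F (α.ext g s) = α'.ext g (F s) * F (α.one g) := by
  have h (s : S) : F (α.ext g s) = α'.ext g (F (s * α.one g⁻¹)) := by
    unfold UnitalPartialAction.ext
    rw [hact]
    congr 2
    exact Subtype.ext (α'.mul_one_of_mem (hF _ _ (α.mul_one_mem _ _))).symm
  have h1 := h 1
  rw [one_mul, α.ext_one] at h1
  rw [h, h1, map_mul, α'.ext_mul]

/-- A partial isomorphism of partial Galois extensions maps `S_g` onto `S'_g`. -/
theorem map_one_of_partial [Finite G] (hT : IsGlobalization α.toPartialAction β φ)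
    (hS : IsPartialExtension α ι) (hT' : IsGlobalization α'.toPartialAction β' φ')
    (hS' : IsPartialExtension α' ι') {F : S ≃ₐ[k] S'}
    (hlin : ∀ r, F (ι r) = ι' r)
    (hF : ∀ (g : G) (s : S), s ∈ α.dom g → F s ∈ α'.dom g)
    (hact : ∀ (g : G) (x : α.dom g⁻¹), F (α.act g x) = α'.act g ⟨F x, hF g⁻¹ x x.2⟩)
    (g : G) : F (α.one g) = α'.one g := by
  have := Fintype.ofFinite G
  obtain ⟨m, x, y, τ, hτ, hxy⟩ := hS.exists_dual_basis hT
  obtain ⟨n, a, b, h1, h2⟩ := hS'.exists_separating hT' g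
  have hu : F (α.one g) * α'.one g = F (α.one g) :=
    α'.mul_one_of_mem (hF _ _ (by simpa using α.mul_one_mem g 1))
  have huu : F (α.one g) * F (α.one g) = F (α.one g) := by rw [← map_mul, (α.one_idem g).eq]
  -- For `h ≠ g` separation gives zero; for `h = g` the idempotent `F(1_g)` meets its complement.
  have hzero (h : G) : ∑ j, (1 - F (α.one g)) * a j * (α'.ext h (b j) * F (α.one h)) = 0 := by
    have h3 : ∑ j, (1 - F (α.one g)) * a j * (α'.ext h (b j) * F (α.one h)) =
        (1 - F (α.one g)) * F (α.one h) * ∑ j, a j * α'.ext h (b j) := by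
      rw [Finset.mul_sum]
      exact Finset.sum_congr rfl fun j _ => by ring
    rw [h3]
    by_cases hh : h = g
    · subst hh
      linear_combination (-(∑ j, a j * α'.ext h (b j))) * huu
    · rw [h2 h hh, mul_zero]
  -- Expansion of `α'_g` in the maps `F(1_h) α'_h`. The other factors do not depend on `j`, so the
  -- sum over `j` can be taken inside.
  have hb (j : Fin n) : α'.ext g (b j) = ∑ i, ∑ h,
      α'.ext h (b j) * F (α.one h) * (F (α.ext h (y i)) * α'.ext g (F (x i))) := by
    -- The trace expansion is that of `S`, transported by `F`; its coefficients lie in `R`, so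
    -- `α'_g` passes over them.
    have h3 : b j = ∑ i, ι' (τ (F.symm (b j) * y i)) * F (x i) := by
      have h4 := congrArg F (hxy (F.symm (b j)))
      rw [AlgEquiv.apply_symm_apply, map_sum] at h4
      rw [← h4]
      exact Finset.sum_congr rfl fun i _ => by rw [map_mul, hlin, h4]
    nth_rewrite 1 [h3]
    rw [α'.ext_sum]
    refine Finset.sum_congr rfl fun i _ => ?_
    rw [hS'.ext_apply_mul, ← hlin, hτ, map_sum, Finset.sum_mul]
    refine Finset.sum_congr rfl fun h _ => ?_
    rw [α.ext_mul, map_mul, map_ext_of_partial hF hact, AlgEquiv.apply_symm_apply, mul_assoc]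
  -- Together with `hu`, which says `F(1_g) ∈ S'_g`, this forces the two idempotents to agree.
  have h4 : (1 - F (α.one g)) * α'.one g = 0 := by
    rw [← h1, Finset.mul_sum]
    calc ∑ j, (1 - F (α.one g)) * (a j * α'.ext g (b j))
        = ∑ i, ∑ h, (∑ j, (1 - F (α.one g)) * a j * (α'.ext h (b j) * F (α.one h))) *
            (F (α.ext h (y i)) * α'.ext g (F (x i))) := by
          simp_rw [Finset.sum_mul]
          rw [Finset.sum_congr rfl fun i _ => Finset.sum_comm, Finset.sum_comm]
          refine Finset.sum_congr rfl fun j _ => ?_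
          rw [hb, ← mul_assoc, Finset.mul_sum]
          refine Finset.sum_congr rfl fun i _ => ?_
          rw [Finset.mul_sum]
          exact Finset.sum_congr rfl fun h _ => by ring
      _ = 0 := Finset.sum_eq_zero fun i _ => Finset.sum_eq_zero fun h _ => by
          rw [hzero, zero_mul]
  linear_combination -h4 - hu

/-- A `k`-algebra isomorphism commuting with the maps `α_g` extends to the globalizations. -/
theorem exists_globalization_equiv (hT : IsGlobalization α.toPartialAction β φ)
    (hT' : IsGlobalization α'.toPartialAction β' φ') (F : S ≃ₐ[k] S')
    (hF : ∀ (g : G) (s : S), F (α.ext g s) = α'.ext g (F s)) :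
    ∃ f : T ≃ₐ[k] T', ∀ t g, hT'.toFunctions (f t) g = F (hT.toFunctions t g) := by
  let P : (G → S) ≃ₐ[k] (G → S') := AlgEquiv.piCongrRight fun _ => F
  -- On the additive generators `β_h(s)` of `T` the function is `g ↦ α_{gh}(s)`, which involves only
  -- `α`. Hence the images of `T` and `T'` correspond under `F`.
  have hP (h : G) (s : S) : P (hT.toFunctions (β h (φ s))) = hT'.toFunctions (β' h (φ' (F s))) := by
    funext g
    rw [hT'.toFunctions_act_map, ← hF, ← hT.toFunctions_act_map]
    rfl
  have h1 (t : T) : ∃ t', hT'.toFunctions t' = P (hT.toFunctions t) := by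
    induction t using hT.induction_on with
    | act_map g s => exact ⟨_, (hP g s).symm⟩
    | add x y hx hy =>
      obtain ⟨x', hx⟩ := hx
      obtain ⟨y', hy⟩ := hy
      exact ⟨x' + y', by simp only [map_add, hx, hy]⟩
  have h2 (t' : T') : ∃ t, P (hT.toFunctions t) = hT'.toFunctions t' := by
    induction t' using hT'.induction_on with
    | act_map g s => exact ⟨β g (φ (F.symm s)), by rw [hP, AlgEquiv.apply_symm_apply]⟩
    | add x y hx hy =>
      obtain ⟨x', hx⟩ := hx
      obtain ⟨y', hy⟩ := hy
      exact ⟨x' + y', by simp only [map_add, hx, hy]⟩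
  let Φ : T →ₐ[k] (G → S') := (P : (G → S) →ₐ[k] (G → S')).comp hT.toFunctions
  have hΦ : Function.Injective Φ := P.injective.comp hT.toFunctions_injective
  have hr : Φ.range = hT'.toFunctions.range := by
    ext u
    constructor
    · rintro ⟨t, rfl⟩
      exact h1 t
    · rintro ⟨t', rfl⟩
      exact h2 t'
  refine ⟨((AlgEquiv.ofInjective Φ hΦ).trans (Subalgebra.equivOfEq _ _ hr)).trans
    (AlgEquiv.ofInjective _ hT'.toFunctions_injective).symm, fun t g => ?_⟩
  have h3 := congrArg Subtype.val (AlgEquiv.apply_symm_apply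
    (AlgEquiv.ofInjective _ hT'.toFunctions_injective)
    (Subalgebra.equivOfEq _ _ hr (AlgEquiv.ofInjective Φ hΦ t)))
  exact congrFun h3 g

theorem GloballyIsomorphic.of_partiallyIsomorphic [Finite G]
    (hT : IsGlobalization α.toPartialAction β φ)
    (hS : IsPartialExtension α ι) (hT' : IsGlobalization α'.toPartialAction β' φ')
    (hS' : IsPartialExtension α' ι')
    (H : PartiallyIsomorphic α.toPartialAction ι α'.toPartialAction ι') :
    GloballyIsomorphic hT hS hT' hS' := by
  obtain ⟨F, hlin, hF, hact⟩ := H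
  have hlin' (r : R) : F (ι r) = ι' r := by simpa using hlin r 1
  have hone := map_one_of_partial hT hS hT' hS' hlin' hF hact
  have hext (g : G) (s : S) : F (α.ext g s) = α'.ext g (F s) := by
    rw [map_ext_of_partial hF hact, hone, α'.ext_mul_one]
  obtain ⟨f, hf⟩ := exists_globalization_equiv hT hT' F hext
  refine ⟨f, fun a t => ?_, fun g t => ?_, ?_⟩
  · rw [map_mul]
    congr 1
    -- Elements of `T^{β_G}` give constant functions with values in the image of `R`, so
    -- `A`-linearity reduces to `F ∘ ι = ι'`.
    apply hT'.toFunctions_injective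
    funext g
    rw [hf, hT.toFunctions_apply, hT'.toFunctions_apply, a.2 g (Subgroup.mem_top g),
      ((hT'.baseEquiv hS').symm (hT.baseEquiv hS a)).2 g (Subgroup.mem_top g),
      ← hT.apply_baseEquiv hS, ← hT'.apply_baseEquiv hS', AlgEquiv.apply_symm_apply, hlin']
  · apply hT'.toFunctions_injective
    funext h
    rw [hf, hT.toFunctions_act, hT'.toFunctions_act, hf]
  · apply hT'.toFunctions_injective
    funext h
    rw [hf, hT.toFunctions_apply, hT'.toFunctions_apply, hT.mulOne_act_map, hT'.mulOne_act_map,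
      hext, map_one]

end PartialIsomorphism
-- From an isomorphism of globalizations to the quotient actions.
section Restrict

variable {k Q B C : Type*} [CommRing k] [Group Q] [CommRing B] [Algebra k B]
  [CommRing C] [Algebra k C] (γ : Q →* (C ≃ₐ[k] C)) (m : C →ₐ[k] B) (ψ : B →ₙₐ[k] C)

/-- The cut-off by the idempotent of the domain is absorbed: `γ_q` sends `ψ(1) γ_{q⁻¹}(ψ 1)` to
`γ_q(ψ 1) ψ(1)`, and `m(ψ 1) = 1`. -/
theorem restrictAction_ext (h1 : ∀ b, m (ψ b) = b) (h2 : ∀ c, ψ (m c) = c * ψ 1) (q : Q) (b : B) :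
    (restrictAction γ m ψ h1 h2).ext q b = m (γ q (ψ b)) := by
  change m (γ q (ψ (b * m (ψ 1 * γ q⁻¹ (ψ 1))))) = _
  rw [map_mul ψ, h2, map_mul (γ q), map_mul (γ q), map_mul (γ q), ← AlgEquiv.mul_apply,
    ← map_mul γ, mul_inv_cancel, map_one γ, AlgEquiv.one_apply]
  simp only [map_mul m, h1, mul_one]
  rw [← map_mul m, ← map_mul (γ q), ← map_mul m, ← map_mul (γ q), ← map_mul ψ, ← map_mul ψ,
    mul_one, mul_one]

end Restrict

section GlobalIsomorphism

variable {k G R S S' T T' : Type*} [CommRing k] [Group G] [CommRing R]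
  [Algebra k R] [CommRing S] [Algebra k S] [CommRing S'] [Algebra k S'] [CommRing T]
  [Algebra k T] [CommRing T'] [Algebra k T']
  {α : UnitalPartialAction k G S} {β : G →* (T ≃ₐ[k] T)} {φ : S →ₙₐ[k] T} {ι : R →ₐ[k] S}
  {α' : UnitalPartialAction k G S'} {β' : G →* (T' ≃ₐ[k] T')} {φ' : S' →ₙₐ[k] T'}
  {ι' : R →ₐ[k] S'}

/-- An isomorphism `T ≃ T'` that maps `1_S` to `1_{S'}` restricts to an isomorphism `S ≃ S'`. -/
theorem exists_restrict_equiv (hT : IsGlobalization α.toPartialAction β φ)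
    (hT' : IsGlobalization α'.toPartialAction β' φ') (f : T ≃ₐ[k] T') (h1 : f (φ 1) = φ' 1) :
    ∃ F : S ≃ₐ[k] S', ∀ s, φ' (F s) = f (φ s) := by
  have hφ (s : S) : φ s * φ 1 = φ s := by rw [← map_mul, mul_one]
  have hφ' (s : S') : φ' s * φ' 1 = φ' s := by rw [← map_mul, mul_one]
  have h1' : f.symm (φ' 1) = φ 1 := by rw [← h1, AlgEquiv.symm_apply_apply]
  -- Since `f(1_S) = 1_{S'}`, the element `f(φ s)` already lies in `T' 1_{S'} = φ'(S')`, so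
  -- multiplication by `1_{S'}` does not change it.
  have hF (s : S) : φ' (hT'.mulOne (f (φ s))) = f (φ s) := by
    rw [hT'.map_mulOne, ← h1, ← map_mul, hφ]
  have hF' (s : S') : φ (hT.mulOne (f.symm (φ' s))) = f.symm (φ' s) := by
    rw [hT.map_mulOne, ← h1', ← map_mul, hφ']
  let F : S →ₐ[k] S' := AlgHom.ofLinearMap
    (hT'.mulOne.toLinearMap ∘ₗ f.toLinearMap ∘ₗ (φ : S →ₗ[k] T))
    (hT'.injective (by
      change φ' (hT'.mulOne (f (φ 1))) = _
      rw [hF, h1]))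
    (fun s t => hT'.injective (by
      change φ' (hT'.mulOne (f (φ (s * t)))) =
        φ' (hT'.mulOne (f (φ s)) * hT'.mulOne (f (φ t)))
      rw [map_mul φ', hF, hF, hF, map_mul φ, map_mul f]))
  refine ⟨AlgEquiv.ofBijective F ⟨fun s t h => ?_, fun s => ⟨hT.mulOne (f.symm (φ' s)), ?_⟩⟩, hF⟩
  · have h2 : φ' (hT'.mulOne (f (φ s))) = φ' (hT'.mulOne (f (φ t))) := congrArg φ' h
    rw [hF, hF] at h2
    exact hT.injective (f.injective h2)
  · apply hT'.injective
    change φ' (hT'.mulOne (f (φ _))) = _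
    rw [hF, hF', AlgEquiv.apply_symm_apply]

theorem map_ext_of_global (hT : IsGlobalization α.toPartialAction β φ)
    (hT' : IsGlobalization α'.toPartialAction β' φ') {f : T ≃ₐ[k] T'}
    (hf : ∀ (g : G) (t : T), f (β g t) = β' g (f t)) {F : S ≃ₐ[k] S'}
    (hF : ∀ s, φ' (F s) = f (φ s)) (g : G) (s : S) : F (α.ext g s) = α'.ext g (F s) := by
  apply hT'.injective
  rw [hF, hT.map_ext, hT'.map_ext, hF, map_mul, hf, ← hF 1, map_one]

/-- The maps `α.ext g` determine the whole partial action, domains included, because `1_g` is the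
image of `1`. -/
theorem PartiallyIsomorphic.of_map_ext {F : S ≃ₐ[k] S'}
    (hlin : ∀ (r : R) (s : S), F (ι r * s) = ι' r * F s)
    (hF : ∀ (g : G) (s : S), F (α.ext g s) = α'.ext g (F s)) :
    PartiallyIsomorphic α.toPartialAction ι α'.toPartialAction ι' := by
  refine ⟨F, hlin, fun g s hs => ?_, fun g x => ?_⟩
  · rw [α'.mem_dom_iff, ← α'.ext_one, ← map_one F, ← hF, ← map_mul, α.ext_one,
      α.mul_one_of_mem hs]
  · rw [← α.ext_of_mem, hF, ← α'.ext_of_mem]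

theorem map_mem_invariants_iff {F : S ≃ₐ[k] S'}
    (hF : ∀ (g : G) (s : S), F (α.ext g s) = α'.ext g (F s)) (H : Subgroup G) (s : S) :
    F s ∈ α'.invariants H ↔ s ∈ α.invariants H := by
  refine forall₂_congr fun h _ => ?_
  rw [← hF, ← α'.ext_one, ← map_one F, ← hF, ← map_mul, F.injective.eq_iff, α.ext_one]

/-- Both sides use the same enumeration of `H`, so the idempotents correspond factor by factor. -/
theorem map_enumIdem [Finite G] {f : T ≃ₐ[k] T'}
    (hf : ∀ (g : G) (t : T), f (β g t) = β' g (f t)) (h1 : f (φ 1) = φ' 1) (H : Subgroup G)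
    (i : Fin (Nat.card H)) : f (enumIdem β φ H i) = enumIdem β' φ' H i := by
  unfold enumIdem
  simp only [map_mul, map_prod, map_sub, map_one, hf, h1]

theorem map_psi [Finite G] {f : T ≃ₐ[k] T'}
    (hf : ∀ (g : G) (t : T), f (β g t) = β' g (f t)) (h1 : f (φ 1) = φ' 1) (H : Subgroup G)
    (t : T) : f (psi β φ H t) = psi β' φ' H (f t) := by
  unfold psi
  rw [map_sum]
  exact Finset.sum_congr rfl fun i _ => by rw [map_mul, hf, map_enumIdem hf h1]

theorem IsGlobalization.map_quotient_ext [Finite G] (hT : IsGlobalization α.toPartialAction β φ)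
    (H : Subgroup G) [H.Normal] (g : G) (s : α.invariants H) :
    φ ((hT.quotient H).ext (g : G ⧸ H) s) = β g (psi β φ H (φ s)) * φ 1 := by
  unfold quotient
  rw [restrictAction_ext]
  exact hT.map_mulOne _

theorem GloballyIsomorphic.exists_equiv [Finite G]
    {hT : IsGlobalization α.toPartialAction β φ}
    {hS : IsPartialExtension α ι} {hT' : IsGlobalization α'.toPartialAction β' φ'}
    {hS' : IsPartialExtension α' ι'} (h : GloballyIsomorphic hT hS hT' hS') :
    ∃ (f : T ≃ₐ[k] T') (F : S ≃ₐ[k] S'), (∀ (g : G) (t : T), f (β g t) = β' g (f t)) ∧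
      f (φ 1) = φ' 1 ∧ (∀ s, φ' (F s) = f (φ s)) ∧
      ∀ (r : R) (s : S), F (ι r * s) = ι' r * F s := by
  obtain ⟨f, hlin, hf, h1⟩ := h
  obtain ⟨F, hF⟩ := exists_restrict_equiv hT hT' f h1
  refine ⟨f, F, hf, h1, hF, fun r s => hT'.injective ?_⟩
  rw [hF, map_mul φ, hT.map_apply hS, mul_assoc, hlin, AlgEquiv.apply_symm_apply, ← map_mul φ,
    one_mul, map_mul φ', hT'.map_apply hS', hF, mul_assoc, ← h1, ← map_mul f, ← map_mul φ,
    one_mul]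

theorem PartiallyIsomorphic.quotient_of_globallyIsomorphic [Finite G]
    {hT : IsGlobalization α.toPartialAction β φ}
    {hS : IsPartialExtension α ι} {hT' : IsGlobalization α'.toPartialAction β' φ'}
    {hS' : IsPartialExtension α' ι'} (h : GloballyIsomorphic hT hS hT' hS')
    (H : Subgroup G) [H.Normal] :
    PartiallyIsomorphic (hT.quotient H).toPartialAction (hS.toInvariants H)
      (hT'.quotient H).toPartialAction (hS'.toInvariants H) := by
  obtain ⟨f, F, hf, h1, hF, hlin⟩ := h.exists_equiv
  have hext := map_ext_of_global hT hT' hf hF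
  have hmap : (α.invariants H).map (F : S →ₐ[k] S') = α'.invariants H := by
    ext s
    rw [← F.apply_symm_apply s, map_mem_invariants_iff hext]
    exact Subalgebra.mem_map.trans
      ⟨fun ⟨x, hx, h⟩ => F.injective h ▸ hx, fun h => ⟨_, h, rfl⟩⟩
  let E : α.invariants H ≃ₐ[k] α'.invariants H :=
    (F.subalgebraMap (α.invariants H)).trans (Subalgebra.equivOfEq _ _ hmap)
  refine PartiallyIsomorphic.of_map_ext (F := E) (fun r s => Subtype.ext (hlin r s)) ?_
  intro q s
  induction q using QuotientGroup.induction_on with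
  | H g =>
    apply Subtype.ext
    apply hT'.injective
    rw [hT'.map_quotient_ext]
    -- Compared inside `T'`, both sides are `β'_g(ψ_H(·)) 1_{S'}`, and `f` respects each ingredient.
    change φ' (F ((hT.quotient H).ext (g : G ⧸ H) s)) = β' g (psi β' φ' H (φ' (F s))) * φ' 1
    rw [hF, hT.map_quotient_ext, map_mul, hf, map_psi hf h1, hF, h1]

/-! ### The quotient by the trivial subgroup. -/

theorem psi_bot [Finite G] (β : G →* (T ≃ₐ[k] T)) (φ : S →ₙₐ[k] T) (t : T) :
    psi β φ ⊥ t = t * φ 1 := by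
  have hi (i : Fin (Nat.card (⊥ : Subgroup G))) : (subgroupEnum ⊥ i : G) = 1 :=
    Subgroup.mem_bot.mp (subgroupEnum ⊥ i).2
  have hsub : Subsingleton (Fin (Nat.card (⊥ : Subgroup G))) :=
    (subgroupEnum (⊥ : Subgroup G)).subsingleton
  unfold psi enumIdem
  rw [Fintype.sum_subsingleton _ ⟨0, Nat.card_pos⟩, hi, map_one, AlgEquiv.one_apply,
    AlgEquiv.one_apply, Finset.filter_false_of_mem, Finset.prod_empty, one_mul]
  intro j _
  rw [Subsingleton.elim j ⟨0, Nat.card_pos⟩]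
  exact lt_irrefl _

theorem IsGlobalization.quotient_bot_ext [Finite G] (hT : IsGlobalization α.toPartialAction β φ)
    (g : G) (s : α.invariants ⊥) :
    ((hT.quotient ⊥).ext (g : G ⧸ (⊥ : Subgroup G)) s : S) = α.ext g s := by
  apply hT.injective
  rw [hT.map_quotient_ext, psi_bot, ← map_mul φ, mul_one, hT.map_ext]

theorem IsGlobalization.mem_quotient_bot_dom_iff [Finite G]
    (hT : IsGlobalization α.toPartialAction β φ) (g : G) (s : α.invariants ⊥) :
    s ∈ (hT.quotient ⊥).dom (g : G ⧸ (⊥ : Subgroup G)) ↔ (s : S) ∈ α.dom g := by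
  rw [(hT.quotient ⊥).mem_dom_iff, α.mem_dom_iff, ← (hT.quotient ⊥).ext_one, ← α.ext_one,
    Subtype.ext_iff, MulMemClass.coe_mul, hT.quotient_bot_ext, OneMemClass.coe_one]

theorem UnitalPartialAction.invariants_bot (α : UnitalPartialAction k G S) :
    α.invariants ⊥ = ⊤ := by
  refine eq_top_iff.mpr fun s _ h hh => ?_
  rw [Subgroup.mem_bot.mp hh, α.ext_one_apply, α.one_one, mul_one]

theorem PartiallyIsomorphic.of_quotient_bot [Finite G]
    (hT : IsGlobalization α.toPartialAction β φ)
    (hS : IsPartialExtension α ι) (hT' : IsGlobalization α'.toPartialAction β' φ')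
    (hS' : IsPartialExtension α' ι')
    (h : PartiallyIsomorphic (hT.quotient ⊥).toPartialAction (hS.toInvariants ⊥)
      (hT'.quotient ⊥).toPartialAction (hS'.toInvariants ⊥)) :
    PartiallyIsomorphic α.toPartialAction ι α'.toPartialAction ι' := by
  obtain ⟨E, hlin, hE, hact⟩ := h
  let e : S ≃ₐ[k] α.invariants ⊥ :=
    Subalgebra.topEquiv.symm.trans (Subalgebra.equivOfEq _ _ α.invariants_bot.symm)
  let e' : α'.invariants ⊥ ≃ₐ[k] S' :=
    (Subalgebra.equivOfEq _ _ α'.invariants_bot).trans Subalgebra.topEquiv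
  have hF : ∀ (g : G) (s : S), s ∈ α.dom g → ((e.trans E).trans e') s ∈ α'.dom g := fun g s hs =>
    (hT'.mem_quotient_bot_dom_iff g (E (e s))).mp
      (hE _ _ ((hT.mem_quotient_bot_dom_iff g (e s)).mpr hs))
  refine ⟨(e.trans E).trans e', fun r s => congrArg Subtype.val (hlin r (e s)), hF, fun g x => ?_⟩
  -- The inverse of the coset of `g` is by definition the coset of `g⁻¹`.
  have hx : e x ∈ (hT.quotient ⊥).dom (g : G ⧸ (⊥ : Subgroup G))⁻¹ :=
    (hT.mem_quotient_bot_dom_iff g⁻¹ (e x)).mpr x.2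
  have h1 := hact (g : G ⧸ (⊥ : Subgroup G)) ⟨e x, hx⟩
  rw [← UnitalPartialAction.ext_of_mem, ← UnitalPartialAction.ext_of_mem] at h1
  have h2 : (hT.quotient ⊥).ext (g : G ⧸ (⊥ : Subgroup G)) (e x) = e (α.act g x) :=
    Subtype.ext ((hT.quotient_bot_ext g (e x)).trans (α.ext_of_mem x))
  rw [h2] at h1
  have h3 := congrArg Subtype.val h1
  rw [hT'.quotient_bot_ext] at h3
  rw [← α'.ext_of_mem]
  exact h3

end GlobalIsomorphism

theorem theorem4p1 {k G R S S' T T' : Type*} [CommRing k] [Group G] [Finite G]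
    [CommRing R] [Algebra k R] [CommRing S] [Algebra k S] [CommRing S'] [Algebra k S']
    [CommRing T] [Algebra k T] [CommRing T'] [Algebra k T']
    (α : UnitalPartialAction k G S) (α' : UnitalPartialAction k G S')
    (β : G →* (T ≃ₐ[k] T)) (φ : S →ₙₐ[k] T) (hT : IsGlobalization α.toPartialAction β φ)
    (β' : G →* (T' ≃ₐ[k] T')) (φ' : S' →ₙₐ[k] T')
    (hT' : IsGlobalization α'.toPartialAction β' φ')
    (ι : R →ₐ[k] S) (hS : IsPartialExtension α ι)
    (ι' : R →ₐ[k] S') (hS' : IsPartialExtension α' ι') :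
    List.TFAE [
      GloballyIsomorphic hT hS hT' hS',
      ∀ (H : Subgroup G) [H.Normal],
        PartiallyIsomorphic (hT.quotient H).toPartialAction (hS.toInvariants H)
          (hT'.quotient H).toPartialAction (hS'.toInvariants H),
      PartiallyIsomorphic α.toPartialAction ι α'.toPartialAction ι'] := by
  tfae_have 1 → 2 := fun h H _ => PartiallyIsomorphic.quotient_of_globallyIsomorphic h H
  tfae_have 2 → 3 := fun h => PartiallyIsomorphic.of_quotient_bot hT hS hT' hS' (h ⊥)
  tfae_have 3 → 1 := GloballyIsomorphic.of_partiallyIsomorphic hT hS hT' hS'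
  tfae_finish
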